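/- For an ordinal $\alpha$ let $2^{<\alpha}$ (resp. $2^{\le\alpha}$) be the set of all functions from some ordinal $\beta<\alpha$ (resp. $\beta\le\alpha$) to $2=\{0,1\}$, ordered by $s\le t\iff s\subseteq t$. A tree $T\subseteq 2^{<\alpha}$ is a downward closed subset of $2^{<\alpha}$; its levels are the sets $\{t\in T: \operatorname{dom}(t)=\beta\}$, its branches are its maximal chains, and the Cantor tree is $2^{\le\omega}$. For a point $x$ of a space $X$, $\chi(x,X)$ denotes the least infinite cardinal $\kappa$ such that $x$ has a local base of size at most $\kappa$, and the character of $X$ is $\sup_{x\in X}\chi(x,X)$. A space is zero-dimensional if its clopen sets form a base. **Proposition 3.1.** Assume CH, i.e. $2^{\omega}=\omega_1$. Suppose there is a tree $T\subseteq 2^{<\omega_2}$ such that 1. each level of $T$ has cardinality at most $\omega_1$; 2. $T$ has no branch of size $\omega_2$; 3. $|T|>2^{\omega}$, or $T$ has strictly more than $2^{\omega}$ branches; 4. $T$ does not contain an isomorphic copy of the Cantor tree, i.e. no subset of $T$ with the induced order is isomorphic to $2^{\le\omega}$. Then there exist zero-dimensional $T_1$ Lindelöf spaces $X$, $X_0$,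 $X_1$ such that $X$ is a Hausdorff Lindelöf space of size $>2^{\omega}$, $X_0$ and $X_1$ are regular $T_1$ Lindelöf spaces of character $\le\omega_1$, and: 1. $X_0$ and $X_1$ have the same underlying set as $X$, and their topologies are finer than (contain) that of $X$. 2. For every $x\in X$, $\chi(x,X_0)=\chi(x,X_1)$. 3. For every $x\in X$ with $\chi(x,X_0)=\chi(x,X_1)=\omega_1$ there is a sequence $\langle O^x_\alpha:\alpha<\omega_1\rangle$ of clopen subsets of $X$ such that $O^x_\alpha\supseteq O^x_{\alpha+1}$ for all $\alpha<\omega_1$, $O^x_\alpha=\bigcap_{\beta<\alpha}O^x_\beta$ for every (nonzero) limit $\alpha<\omega_1$, and $\bigcap_{\alpha<\omega_1}O^x_\alpha=\{x\}$. 4. For every $x\in X$ with $\chi(x,X_0)=\chi(x,X_1)=\omega$ there are an open set $O_0$ of $X_0$ and an open set $O_1$ of $X_1$ with $O_0\cap O_1=\{x\}$. -/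

import Mathlib

open Set Cardinal TopologicalSpace
open scoped Topology

universe u

/-- A transfinite 0-1 sequence: a function from the ordinal `dom`, i.e. from the set of the
ordinals below `dom`, to `2 = {false, true}`. -/
structure BinSeq : Type (u + 1) where
  dom : Ordinal.{u}
  val : Set.Iio dom → Bool

namespace BinSeq

/-- `s ≤ t` iff `s ⊆ t` as functions (sets of ordered pairs), i.e. `t` extends `s`. -/
instance : PartialOrder BinSeq.{u} where
  le s t := ∃ h : s.dom ≤ t.dom, ∀ β : Set.Iio s.dom, s.val β = t.val ⟨β.1, β.2.trans_le h⟩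
  le_refl s := ⟨le_rfl, fun _ => rfl⟩
  le_trans s t r := by
    rintro ⟨h, hst⟩ ⟨k, htr⟩
    exact ⟨h.trans k, fun β => (hst β).trans (htr _)⟩
  le_antisymm s t := by
    rintro ⟨h, hst⟩ ⟨k, -⟩
    obtain ⟨a, f⟩ := s
    obtain ⟨b, g⟩ := t
    obtain rfl : a = b := le_antisymm h k
    obtain rfl : f = g := funext hst
    rfl

end BinSeq

/-- `2^{<α}`. -/
def binSeqLT (α : Ordinal.{u}) : Set BinSeq.{u} := {s | s.dom < α}

/-- `2^{≤α}`. -/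
def binSeqLE (α : Ordinal.{u}) : Set BinSeq.{u} := {s | s.dom ≤ α}

/-- `T` is a tree contained in `2^{<α}`: a downward closed subset of `2^{<α}`. -/
def IsTreeIn (α : Ordinal.{u}) (T : Set BinSeq.{u}) : Prop :=
  T ⊆ binSeqLT α ∧ ∀ s ∈ T, ∀ t ∈ binSeqLT α, t ≤ s → t ∈ T

/-- The level of height `β` of `T`. -/
def treeLevel (T : Set BinSeq.{u}) (β : Ordinal.{u}) : Set BinSeq.{u} := {t ∈ T | t.dom = β}

/-- The branches of `T`: its maximal chains. -/
def branches (T : Set BinSeq.{u}) : Set (Set T) := {B | IsMaxChain (· ≤ ·) B}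

/-- The Cantor tree `2^{≤ω}`. -/
def cantorTree : Set BinSeq.{u} := binSeqLE Ordinal.omega0

/-- `T` contains an isomorphic copy of the Cantor tree: some subset of `T`, with the order of `T`,
is isomorphic to it. -/
def ContainsCantorTree (T : Set BinSeq.{u}) : Prop :=
  ∃ S : Set BinSeq.{u}, S ⊆ T ∧ Nonempty (cantorTree.{u} ≃o S)

/-- `ℬ` is a local base at `x`, consisting of open sets. -/
def IsLocalBase {X : Type u} (τ : TopologicalSpace X) (x : X) (ℬ : Set (Set X)) : Prop :=
  (∀ U ∈ ℬ, IsOpen[τ] U ∧ x ∈ U) ∧ ∀ V : Set X, IsOpen[τ] V → x ∈ V → ∃ U ∈ ℬ, U ⊆ V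

/-- The character `χ(x, X)`: the least infinite cardinal `κ` such that `x` has a local base of size
at most `κ`; so it is `ℵ₀` at an isolated point. -/
noncomputable def pointCharacter {X : Type u} (τ : TopologicalSpace X) (x : X) : Cardinal.{u} :=
  sInf {κ | ℵ₀ ≤ κ ∧ ∃ ℬ : Set (Set X), IsLocalBase τ x ℬ ∧ #ℬ ≤ κ}

/-- The character `χ(X) = sup {χ(x, X) | x ∈ X}` of a space. -/
noncomputable def spaceCharacter {X : Type u} (τ : TopologicalSpace X) : Cardinal.{u} :=
  ⨆ x : X, pointCharacter τ x

/-- Zero-dimensional: the clopen sets form a base. -/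
def IsZeroDimensional {X : Type u} (τ : TopologicalSpace X) : Prop :=
  @IsTopologicalBasis X τ {U | @IsClopen X τ U}

/-- `τ` is a zero-dimensional `T₁` Lindelöf topology. -/
structure IsZeroDimT1Lindelof {X : Type u} (τ : TopologicalSpace X) : Prop where
  zeroDim : IsZeroDimensional τ
  t1 : @T1Space X τ
  lindelof : @LindelofSpace X τ

/-- `τ` is a regular `T₁` Lindelöf topology of character at most `ℵ₁`. -/
structure IsRegularT1LindelofCharLE {X : Type u} (τ : TopologicalSpace X) : Prop where
  regular : @RegularSpace X τ
  t1 : @T1Space X τ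
  lindelof : @LindelofSpace X τ
  character_le : spaceCharacter τ ≤ ℵ_ 1

/-- The sequence `O` of length `ω₁` (only the values at `α < ω₁` matter) consists of clopen sets,
is decreasing, continuous at limits, and shrinks to the point `x`. -/
structure IsShrinkingClopenSeq {X : Type u} (τ : TopologicalSpace X) (x : X)
    (O : Ordinal.{u} → Set X) : Prop where
  clopen : ∀ α < Ordinal.omega 1, @IsClopen X τ (O α)
  succ_subset : ∀ α < Ordinal.omega 1, O (Order.succ α) ⊆ O α
  limit_eq : ∀ α < Ordinal.omega 1, Order.IsSuccLimit α → O α = ⋂ β < α, O β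
  inter_eq : ⋂ α < Ordinal.omega 1, O α = {x}

/-- The hypotheses on three spaces `X`, `X₀`, `X₁` with a common underlying set, given by the
topologies `τ`, `τ₀`, `τ₁`, under which the points can be modified to get two regular `T₁` Lindelöf
spaces with points `G_δ` whose product has extent `|X|`. -/
structure ModificationHypotheses {X : Type u} (τ τ₀ τ₁ : TopologicalSpace X) : Prop where
  hausdorff : @T2Space X τ
  lindelof : @LindelofSpace X τ
  card_gt : 𝔠 < #X
  space₀ : IsRegularT1LindelofCharLE τ₀
  space₁ : IsRegularT1LindelofCharLE τ₁
  finer₀ : ∀ U : Set X, IsOpen[τ] U → IsOpen[τ₀] U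
  finer₁ : ∀ U : Set X, IsOpen[τ] U → IsOpen[τ₁] U
  character_eq : ∀ x : X, pointCharacter τ₀ x = pointCharacter τ₁ x
  character_aleph_one : ∀ x : X, pointCharacter τ₀ x = ℵ_ 1 → pointCharacter τ₁ x = ℵ_ 1 →
    ∃ O : Ordinal.{u} → Set X, IsShrinkingClopenSeq τ x O
  character_aleph_zero : ∀ x : X, pointCharacter τ₀ x = ℵ₀ → pointCharacter τ₁ x = ℵ₀ →
    ∃ O₀ O₁ : Set X, IsOpen[τ₀] O₀ ∧ IsOpen[τ₁] O₁ ∧ O₀ ∩ O₁ = {x}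

/-! The points are the sequences all of whose proper initial segments lie in `T`. They include `T`,
and each branch of `T` has its union among them, so there are more than continuum many. A point `x`
of limit length that is outside `T` or of uncountable cofinality gets the neighbourhoods `pathNhd b
x r`: everything properly above `r` but not properly above `x`. All other points are isolated. The
three topologies differ only in a set `E` of points of countable cofinality that are isolated as
well: it is empty for `X`, and the two sets used for `X₀` and `X₁` partition the points of countable
cofinality. So each such point is isolated in one of the two spaces, while points of uncountable
cofinality keep character `ω₁`.

The difficulty is the Lindelöf property. If a cover has no countable subcover, call a node bad when
the cone above it is not countably covered. Every bad node has two incompatible bad extensions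
(`exists_incompatible_of_not_countablyCovered`), so the bad nodes contain a full binary tree all of
whose paths have the same length `δ < ω₂` (`exists_isBinarySystem`). If some path has its limit
outside `T ∪ E`, one member of the cover contains the whole cone above some node of that path, a
contradiction.

It remains to choose the sets `E` so that such limits always exist. As `T` has no Cantor subtree,
every binary system has continuum many limits outside `T` (`IsBinarySystem.continuum_le_mk`). By CH
and the bound on the levels there are at most continuum many systems of height `δ`, so a
Bernstein-type recursion splits the limits of all of them at once (`exists_splitting_limits`).
Limits of systems of different heights have different lengths, so the choices for different `δ` do
not interfere. -/

namespace BinSeq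

/-! ### Initial segments, unions of chains, and cofinality of sequences -/

theorem eq_of_le_of_dom_eq {s t : BinSeq.{u}} (h : s ≤ t) (hd : s.dom = t.dom) : s = t :=
  le_antisymm h ⟨hd.ge, fun β => (h.2 ⟨β.1, β.2.trans_eq hd.symm⟩).symm⟩

theorem dom_lt_of_lt {s t : BinSeq.{u}} (h : s < t) : s.dom < t.dom :=
  lt_of_le_of_ne h.le.1 fun hd => h.ne (eq_of_le_of_dom_eq h.le hd)

theorem le_of_dom_le {r s t : BinSeq.{u}} (hr : r ≤ t) (hs : s ≤ t) (hd : r.dom ≤ s.dom) :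
    r ≤ s :=
  ⟨hd, fun β => (hr.2 β).trans (hs.2 ⟨β.1, β.2.trans_le hd⟩).symm⟩

theorem lt_of_dom_lt {r s t : BinSeq.{u}} (hr : r ≤ t) (hs : s ≤ t) (hd : r.dom < s.dom) :
    r < s :=
  lt_of_le_of_ne (le_of_dom_le hr hs hd.le) fun h => hd.ne (congrArg dom h)

theorem le_total_of_le {r s t : BinSeq.{u}} (hr : r ≤ t) (hs : s ≤ t) : r ≤ s ∨ s ≤ r :=
  (le_total r.dom s.dom).imp (le_of_dom_le hr hs) (le_of_dom_le hs hr)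

theorem lt_of_not_le {r s t : BinSeq.{u}} (hr : r ≤ t) (hs : s ≤ t) (h : ¬ r ≤ s) : s < r :=
  lt_of_le_not_ge ((le_total_of_le hr hs).resolve_left h) h

theorem exists_le_dom_eq (s : BinSeq.{u}) {β : Ordinal.{u}} (h : β ≤ s.dom) :
    ∃ r ≤ s, r.dom = β :=
  ⟨⟨β, fun γ => s.val ⟨γ.1, γ.2.trans_le h⟩⟩, ⟨h, fun _ => rfl⟩, rfl⟩

theorem exists_lt_dom_eq (s : BinSeq.{u}) {β : Ordinal.{u}} (h : β < s.dom) :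
    ∃ r < s, r.dom = β := by
  obtain ⟨r, hr, rfl⟩ := s.exists_le_dom_eq h.le
  exact ⟨r, lt_of_dom_lt hr le_rfl h, rfl⟩

/-- The empty sequence. -/
def nil : BinSeq.{u} := ⟨0, fun _ => false⟩

theorem nil_le (s : BinSeq.{u}) : nil ≤ s :=
  ⟨zero_le, fun β => absurd (show β.1 < 0 from β.2) (not_lt.2 zero_le)⟩

open Classical in
/-- The extension of a sequence by one more value. -/
noncomputable def snoc (s : BinSeq.{u}) (i : Bool) : BinSeq.{u} :=
  ⟨Order.succ s.dom, fun β => if h : β.1 < s.dom then s.val ⟨β.1, h⟩ else i⟩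

theorem lt_snoc (s : BinSeq.{u}) (i : Bool) : s < s.snoc i := by
  have h : s ≤ s.snoc i := ⟨Order.le_succ _, fun β => by
    have : β.1 < s.dom := β.2
    simp [snoc, this]⟩
  refine lt_of_le_of_ne h fun h' => ?_
  exact (Order.lt_succ s.dom).ne (congrArg dom h')

theorem exists_snoc_le {s t : BinSeq.{u}} (h : s < t) : ∃ i, s.snoc i ≤ t := by
  have hd := dom_lt_of_lt h
  refine ⟨t.val ⟨s.dom, hd⟩, Order.succ_le_of_lt hd, fun β => ?_⟩
  by_cases hβ : β.1 < s.dom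
  · simpa [snoc, hβ] using h.le.2 ⟨β.1, hβ⟩
  · have : β.1 = s.dom := le_antisymm (Order.lt_succ_iff.1 β.2) (not_lt.1 hβ)
    simp [snoc, this]

theorem le_of_forall_lt_le {s t : BinSeq.{u}} (hs : Order.IsSuccLimit s.dom)
    (h : ∀ r < s, r ≤ t) : s ≤ t := by
  have key : ∀ β < s.dom, ∃ r ≤ s, r ≤ t ∧ β < r.dom := fun β hβ => by
    obtain ⟨r, hr, hd⟩ := s.exists_lt_dom_eq (hs.succ_lt hβ)
    exact ⟨r, hr.le, h r hr, hd ▸ Order.lt_succ β⟩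
  refine ⟨le_of_forall_lt fun β hβ => ?_, fun β => ?_⟩
  · obtain ⟨r, -, hr, hd⟩ := key β hβ
    exact hd.trans_le hr.1
  · obtain ⟨r, hr, hr', hd⟩ := key β.1 β.2
    exact (hr.2 ⟨β.1, hd⟩).symm.trans (hr'.2 ⟨β.1, hd⟩)

theorem exists_lt_not_le {s t : BinSeq.{u}} (hs : Order.IsSuccLimit s.dom) (h : ¬ s ≤ t) :
    ∃ r < s, ¬ r ≤ t := by
  by_contra! H
  exact h (le_of_forall_lt_le hs H)

theorem exists_between {r s : BinSeq.{u}} (hs : Order.IsSuccLimit s.dom) (h : r < s) :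
    ∃ m, r < m ∧ m < s := by
  obtain ⟨m, hm, hd⟩ := s.exists_lt_dom_eq (hs.succ_lt (dom_lt_of_lt h))
  exact ⟨m, lt_of_dom_lt h.le hm.le (hd ▸ Order.lt_succ _), hm⟩

theorem exists_lt {s : BinSeq.{u}} (hs : Order.IsSuccLimit s.dom) : ∃ r, r < s := by
  obtain ⟨r, hr, -⟩ := s.exists_lt_dom_eq (pos_iff_ne_zero.2 hs.ne_bot)
  exact ⟨r, hr⟩

/-- A bounded chain of sequences has a union. -/
theorem exists_isLUB {S : Set BinSeq.{u}} (hS : IsChain (· ≤ ·) S)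
    (hb : BddAbove (dom '' S)) :
    ∃ b, IsLUB S b ∧ ∀ r < b, ∃ s ∈ S, r < s := by
  classical
  have key : ∀ β : Set.Iio (sSup (dom '' S)), ∃ s : BinSeq.{u}, s ∈ S ∧ β.1 < s.dom := by
    rintro ⟨β, hβ⟩
    obtain ⟨_, ⟨s, hs, rfl⟩, h⟩ := exists_lt_of_lt_csSup' (show β < _ from hβ)
    exact ⟨s, hs, h⟩
  choose g hg hgd using key
  have agree : ∀ s ∈ S, ∀ t ∈ S, ∀ β (h₁ : β < s.dom) (h₂ : β < t.dom),
      s.val ⟨β, h₁⟩ = t.val ⟨β, h₂⟩ := by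
    intro s hs t ht β h₁ h₂
    rcases hS.total hs ht with h | h
    · exact h.2 ⟨β, h₁⟩
    · exact (h.2 ⟨β, h₂⟩).symm
  let b : BinSeq.{u} := ⟨sSup (dom '' S), fun β => (g β).val ⟨β.1, hgd β⟩⟩
  have hub : ∀ s ∈ S, s ≤ b := fun s hs =>
    ⟨le_csSup hb ⟨s, hs, rfl⟩, fun β => agree s hs _ (hg _) _ _ _⟩
  refine ⟨b, ⟨hub, fun c hc => ?_⟩, fun r hr => ?_⟩
  · refine ⟨csSup_le' ?_, fun β => ?_⟩
    · rintro _ ⟨s, hs, rfl⟩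
      exact (hc hs).1
    · exact (hc (hg β)).2 ⟨β.1, hgd β⟩
  · obtain ⟨_, ⟨s, hs, rfl⟩, h⟩ := exists_lt_of_lt_csSup' (dom_lt_of_lt hr)
    exact ⟨s, hs, lt_of_dom_lt hr.le (hub s hs) h⟩

/-- Countably many proper initial segments of `x` are cofinal below `x`. -/
def CountablyCofinal (x : BinSeq.{u}) : Prop :=
  ∃ S : Set BinSeq.{u}, S.Countable ∧ (∀ s ∈ S, s < x) ∧ ∀ r < x, ∃ s ∈ S, r ≤ s

/-- Below the empty sequence the empty set is cofinal, and below a sequence of successor length its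
immediate predecessor alone is. -/
theorem isSuccLimit_of_not_countablyCofinal {x : BinSeq.{u}} (h : ¬ x.CountablyCofinal) :
    Order.IsSuccLimit x.dom := by
  by_contra hx
  apply h
  rcases Ordinal.isSuccLimit_iff.not.1 hx |> not_and_or.1 with h0 | h0
  · refine ⟨∅, countable_empty, by simp, fun r hr => ?_⟩
    have := dom_lt_of_lt hr
    simp only [ne_eq, not_not] at h0
    simp [h0] at this
  · rw [Order.not_isSuccPrelimit_iff] at h0
    obtain ⟨β, hβ⟩ := h0
    obtain ⟨m, hm, hd⟩ := x.exists_lt_dom_eq hβ.lt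
    refine ⟨{m}, countable_singleton m, by simpa using hm, fun r hr => ⟨m, rfl, ?_⟩⟩
    refine le_of_dom_le hr.le hm.le ?_
    rw [hd]
    exact hβ.le_of_lt (dom_lt_of_lt hr)

theorem exists_forall_lt_of_not_countablyCofinal {x : BinSeq.{u}} (h : ¬ x.CountablyCofinal)
    {S : Set BinSeq.{u}} (hS : S.Countable) (hlt : ∀ s ∈ S, s < x) :
    ∃ r < x, ∀ s ∈ S, s < r := by
  by_contra! H
  refine h ⟨S, hS, hlt, fun r hr => ?_⟩
  obtain ⟨s, hs, hsr⟩ := H r hr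
  refine ⟨s, hs, ?_⟩
  by_contra hrs
  exact hsr (lt_of_not_le hr.le (hlt s hs).le hrs)

end BinSeq

/-! ### The branch topology -/

open BinSeq

/-- The sequences all of whose proper initial segments are in `T`. -/
def pathClosure (T : Set BinSeq.{u}) : Set BinSeq.{u} := {s | ∀ r < s, r ∈ T}

/-- The sequences of limit length that are not isolated in the topology of `branchTopology`. -/
def IsLimitPath (T : Set BinSeq.{u}) (x : BinSeq.{u}) : Prop :=
  Order.IsSuccLimit x.dom ∧ (x ∉ T ∨ ¬ x.CountablyCofinal)

/-- The basic neighbourhoods in `branchTopology`. -/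
def pathNhd {X : Type*} (b : X → BinSeq.{u}) (x : X) (r : BinSeq.{u}) : Set X :=
  {y | r < b y ∧ ¬ b x < b y}

theorem pathNhd_anti {X : Type*} (b : X → BinSeq.{u}) (x : X) {r s : BinSeq.{u}} (h : r ≤ s) :
    pathNhd b x s ⊆ pathNhd b x r :=
  fun _ hy => ⟨h.trans_lt hy.1, hy.2⟩

theorem mem_pathNhd {X : Type*} {b : X → BinSeq.{u}} {x : X} {r : BinSeq.{u}} (h : r < b x) :
    x ∈ pathNhd b x r :=
  ⟨h, lt_irrefl _⟩

/-- The topology on a set of sequences (indexed by `b`) in which the limit paths outside `E` have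
the sets `pathNhd b x r`, `r < b x`, as a local base, and all other points are isolated. -/
@[reducible] def branchTopology {X : Type*} (T E : Set BinSeq.{u}) (b : X → BinSeq.{u}) :
    TopologicalSpace X where
  IsOpen U := ∀ x ∈ U, IsLimitPath T (b x) → b x ∉ E → ∃ r < b x, pathNhd b x r ⊆ U
  isOpen_univ x _ hx _ := by
    obtain ⟨r, hr⟩ := exists_lt hx.1
    exact ⟨r, hr, subset_univ _⟩
  isOpen_inter U V hU hV x hx hl hE := by
    obtain ⟨r, hr, hrU⟩ := hU x hx.1 hl hE
    obtain ⟨s, hs, hsV⟩ := hV x hx.2 hl hE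
    rcases le_total_of_le hr.le hs.le with h | h
    · exact ⟨s, hs, subset_inter ((pathNhd_anti b x h).trans hrU) hsV⟩
    · exact ⟨r, hr, subset_inter hrU ((pathNhd_anti b x h).trans hsV)⟩
  isOpen_sUnion 𝒰 h𝒰 x hx hl hE := by
    obtain ⟨U, hU, hxU⟩ := hx
    obtain ⟨r, hr, hrU⟩ := h𝒰 U hU x hxU hl hE
    exact ⟨r, hr, hrU.trans (subset_sUnion_of_mem hU)⟩

section

variable {X : Type*} {T E F : Set BinSeq.{u}} {b : X → BinSeq.{u}}

theorem isOpen_branchTopology_mono (h : E ⊆ F) {U : Set X}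
    (hU : IsOpen[branchTopology T E b] U) : IsOpen[branchTopology T F b] U :=
  fun x hx hl hF => hU x hx hl fun hE => hF (h hE)

theorem isOpen_singleton_branchTopology {x : X}
    (h : IsLimitPath T (b x) → b x ∈ E) : IsOpen[branchTopology T E b] {x} := by
  rintro y rfl hl hE
  exact absurd (h hl) hE

/-- For closedness, take a limit path `x` not properly above `s`. If `x ≤ s`, a basic neighbourhood
of `x` contains nothing properly above `x`, hence nothing properly above `s`. Otherwise some `r < x`
is not below `s`; a common extension of `r` and `s` would force `s < r < x`. -/
theorem isClopen_setOf_lt (s : BinSeq.{u}) :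
    @IsClopen X (branchTopology T E b) {y | s < b y} := by
  let _ := branchTopology T E b
  refine ⟨⟨fun x hx hl _ => ?_⟩, fun x hx _ _ => ⟨s, hx, fun y hy => hy.1⟩⟩
  by_cases h : b x ≤ s
  · obtain ⟨r, hr⟩ := exists_lt hl.1
    exact ⟨r, hr, fun y hy hy' => hy.2 (h.trans_lt hy')⟩
  · obtain ⟨r, hr, hrs⟩ := exists_lt_not_le hl.1 h
    exact ⟨r, hr, fun y hy hy' => hx ((lt_of_not_le hy.1.le hy'.le hrs).trans hr)⟩

theorem isClopen_pathNhd (x : X) (r : BinSeq.{u}) :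
    @IsClopen X (branchTopology T E b) (pathNhd b x r) :=
  let _ := branchTopology T E b
  (isClopen_setOf_lt r).inter (isClopen_setOf_lt (b x)).compl

theorem isClosed_singleton_branchTopology (hb : Function.Injective b) (x : X) :
    IsClosed[branchTopology T E b] {x} := by
  let _ := branchTopology T E b
  refine ⟨fun y hy hl _ => ?_⟩
  by_cases h : b y ≤ b x
  · obtain ⟨r, hr⟩ := exists_lt hl.1
    refine ⟨r, hr, ?_⟩
    rintro z hz rfl
    exact hz.2 (lt_of_le_of_ne h fun h' => hy (hb h'))
  · obtain ⟨r, hr, hrs⟩ := exists_lt_not_le hl.1 h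
    refine ⟨r, hr, ?_⟩
    rintro z hz rfl
    exact hrs hz.1.le

theorem t1Space_branchTopology (hb : Function.Injective b) :
    @T1Space X (branchTopology T E b) :=
  let _ := branchTopology T E b
  ⟨isClosed_singleton_branchTopology hb⟩

theorem exists_pathNhd_subset {U : Set X} {x : X} (hU : IsOpen[branchTopology T E b] U)
    (hx : x ∈ U) (hl : IsLimitPath T (b x)) (hE : b x ∉ E) :
    ∃ r < b x, pathNhd b x r ⊆ U :=
  hU x hx hl hE

end

theorem isZeroDimensional_branchTopology {X : Type u} {T E : Set BinSeq.{u}} {b : X → BinSeq.{u}}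
    (hb : Function.Injective b) : IsZeroDimensional (branchTopology T E b) := by
  let _ := branchTopology T E b
  refine isTopologicalBasis_of_isOpen_of_nhds (fun U hU => hU.isOpen) fun x U hx hU => ?_
  by_cases h : IsLimitPath T (b x) ∧ b x ∉ E
  · obtain ⟨r, hr, hrU⟩ := exists_pathNhd_subset hU hx h.1 h.2
    exact ⟨_, isClopen_pathNhd x r, mem_pathNhd hr, hrU⟩
  · refine ⟨{x}, ⟨isClosed_singleton_branchTopology hb x,
      isOpen_singleton_branchTopology fun hl => ?_⟩, rfl, by simpa using hx⟩
    by_contra hE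
    exact h ⟨hl, hE⟩

theorem regularSpace_of_isZeroDimensional {X : Type u} {τ : TopologicalSpace X}
    (h : IsZeroDimensional τ) : RegularSpace X := by
  refine .of_exists_mem_nhds_isClosed_subset fun x s hs => ?_
  obtain ⟨U, hU, hx, hUs⟩ := (IsTopologicalBasis.mem_nhds_iff h).1 hs
  exact ⟨U, IsOpen.mem_nhds hU.2 hx, hU.1, hUs⟩

/-! ### Characters of points and shrinking clopen sequences -/

section Character

variable {X : Type u} {τ : TopologicalSpace X} {x : X}

theorem pointCharacter_le {κ : Cardinal.{u}} (hκ : ℵ₀ ≤ κ) {ℬ : Set (Set X)}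
    (hℬ : IsLocalBase τ x ℬ) (h : #ℬ ≤ κ) : pointCharacter τ x ≤ κ :=
  csInf_le' ⟨hκ, ℬ, hℬ, h⟩

theorem exists_isLocalBase_card_le (τ : TopologicalSpace X) (x : X) :
    ℵ₀ ≤ pointCharacter τ x ∧
      ∃ ℬ : Set (Set X), IsLocalBase τ x ℬ ∧ #ℬ ≤ pointCharacter τ x :=
  csInf_mem (s := {κ | ℵ₀ ≤ κ ∧ ∃ ℬ : Set (Set X), IsLocalBase τ x ℬ ∧ #ℬ ≤ κ})
    ⟨max ℵ₀ #(Set X), le_max_left _ _, {U | IsOpen[τ] U ∧ x ∈ U},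
      ⟨fun _ hU => hU, fun V hV hx => ⟨V, ⟨hV, hx⟩, Subset.rfl⟩⟩,
      (mk_subtype_le _).trans (le_max_right _ _)⟩

theorem pointCharacter_eq_aleph0 {ℬ : Set (Set X)} (hℬ : IsLocalBase τ x ℬ)
    (h : ℬ.Countable) : pointCharacter τ x = ℵ₀ :=
  le_antisymm (pointCharacter_le le_rfl hℬ (le_aleph0_iff_set_countable.2 h))
    (exists_isLocalBase_card_le τ x).1

theorem pointCharacter_eq_aleph0_of_isOpen_singleton (h : IsOpen[τ] {x}) :
    pointCharacter τ x = ℵ₀ :=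
  pointCharacter_eq_aleph0 (ℬ := {{x}})
    ⟨by simpa using h, fun V _ hx => ⟨{x}, rfl, by simpa using hx⟩⟩ (countable_singleton _)

variable {T E : Set BinSeq.{u}} {b : X → BinSeq.{u}}

theorem isLocalBase_pathNhd (hl : IsLimitPath T (b x)) (hE : b x ∉ E) {S : Set BinSeq.{u}}
    (hS : ∀ s ∈ S, s < b x) (hcof : ∀ r < b x, ∃ s ∈ S, r ≤ s) :
    IsLocalBase (branchTopology T E b) x (pathNhd b x '' S) := by
  let _ := branchTopology T E b
  refine ⟨?_, fun V hV hx => ?_⟩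
  · rintro _ ⟨s, hs, rfl⟩
    exact ⟨(isClopen_pathNhd x s).isOpen, mem_pathNhd (hS s hs)⟩
  · obtain ⟨r, hr, hrV⟩ := exists_pathNhd_subset hV hx hl hE
    obtain ⟨s, hs, hrs⟩ := hcof r hr
    exact ⟨_, ⟨s, hs, rfl⟩, (pathNhd_anti b x hrs).trans hrV⟩

theorem pointCharacter_of_countablyCofinal (hc : (b x).CountablyCofinal) :
    pointCharacter (branchTopology T E b) x = ℵ₀ := by
  by_cases h : IsLimitPath T (b x) ∧ b x ∉ E
  · obtain ⟨S, hS, hlt, hcof⟩ := hc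
    exact pointCharacter_eq_aleph0 (isLocalBase_pathNhd h.1 h.2 hlt hcof) (hS.image _)
  · refine pointCharacter_eq_aleph0_of_isOpen_singleton
      (isOpen_singleton_branchTopology fun hl => ?_)
    by_contra hE
    exact h ⟨hl, hE⟩

/-- The cofinal `ω₁`-sequence `e` gives the upper bound. Given a countable local base, a single `r <
b x` lies above all the nodes associated with its members; the point with sequence `r` is then in
every member, but not in `pathNhd b x r`. -/
theorem pointCharacter_of_not_countablyCofinal (hr : range b = pathClosure T)
    (hc : ¬ (b x).CountablyCofinal) (hE : b x ∉ E) {e : Ordinal.{u} → BinSeq.{u}}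
    (he : ∀ η < Ordinal.omega 1, e η < b x)
    (hcof : ∀ r < b x, ∃ η < Ordinal.omega 1, r ≤ e η) :
    pointCharacter (branchTopology T E b) x = ℵ_ 1 := by
  have hlim := isSuccLimit_of_not_countablyCofinal hc
  have hl : IsLimitPath T (b x) := ⟨hlim, .inr hc⟩
  apply le_antisymm
  · refine pointCharacter_le (aleph0_le_aleph 1)
      (isLocalBase_pathNhd (S := e '' Iio (Ordinal.omega 1)) hl hE ?_ ?_) ?_
    · rintro _ ⟨η, hη, rfl⟩
      exact he η hη
    · intro r hr
      obtain ⟨η, hη, h⟩ := hcof r hr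
      exact ⟨_, ⟨η, hη, rfl⟩, h⟩
    · rw [image_image, ← lift_le.{u + 1}]
      refine mk_image_le_lift.trans ?_
      rw [mk_Iio_ordinal, Ordinal.card_omega]
      simp
  · obtain ⟨h0, ℬ, hℬ, hcard⟩ := exists_isLocalBase_card_le (branchTopology T E b) x
    rw [← succ_aleph0, Order.succ_le_iff]
    refine lt_of_le_of_ne h0 fun heq => ?_
    rw [← heq, le_aleph0_iff_set_countable] at hcard
    have hU : ∀ U : ℬ, ∃ r < b x, pathNhd b x r ⊆ U.1 := fun U =>
      exists_pathNhd_subset (hℬ.1 U U.2).1 (hℬ.1 U U.2).2 hl hE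
    choose g hg hgU using hU
    have := hcard.to_subtype
    obtain ⟨r, hrx, hgr⟩ := exists_forall_lt_of_not_countablyCofinal hc (countable_range g)
      (by rintro _ ⟨U, rfl⟩; exact hg U)
    have hmem : r ∈ range b := by
      rw [hr]
      intro s hs
      have : b x ∈ pathClosure T := hr ▸ mem_range_self x
      exact this s (hs.trans hrx)
    obtain ⟨y, rfl⟩ := hmem
    let _ := branchTopology T E b
    obtain ⟨U, hU, hUV⟩ := hℬ.2 _ (isClopen_pathNhd x (b y)).isOpen (mem_pathNhd hrx)
    have hy : y ∈ pathNhd b x (g ⟨U, hU⟩) := ⟨hgr _ ⟨_, rfl⟩, hrx.not_gt⟩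
    exact lt_irrefl _ (hUV (hgU _ hy)).1

/-- Only openness is delicate. The union `d` of the countably many nodes `e η`, `η < ξ`, is a proper
initial segment of `b x`, hence in `T`, and it has countable cofinality unless one of the nodes
equals it. A limit path extending all these nodes properly therefore cannot be `d` itself: this is
why limit points of `T` of countable cofinality are isolated. -/
theorem isShrinkingClopenSeq_branchTopology (hb : Function.Injective b)
    (hr : range b = pathClosure T)
    (hc : ¬ (b x).CountablyCofinal) {e : Ordinal.{u} → BinSeq.{u}}
    (he : ∀ η < Ordinal.omega 1, e η < b x)
    (hcof : ∀ r < b x, ∃ η < Ordinal.omega 1, r ≤ e η) :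
    IsShrinkingClopenSeq (branchTopology T E b) x
      fun ξ => {y | ¬ b x < b y ∧ ∀ η < ξ, e η < b y} := by
  let _ := branchTopology T E b
  have hlim := isSuccLimit_of_not_countablyCofinal hc
  refine ⟨fun ξ hξ => ⟨?_, ?_⟩,
    fun ξ hξ y hy => ⟨hy.1, fun η hη => hy.2 η (hη.trans (Order.lt_succ ξ))⟩,
    fun ξ hξ hlξ => ?_, ?_⟩
  · have : {y | ¬ b x < b y ∧ ∀ η < ξ, e η < b y}
        = {y | b x < b y}ᶜ ∩ ⋂ η, ⋂ (_ : η < ξ), {y | e η < b y} := by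
      ext y; simp
    rw [this]
    exact (isClopen_setOf_lt _).compl.isClosed.inter
      (isClosed_biInter fun η _ => (isClopen_setOf_lt _).isClosed)
  · intro y hy hl hE
    have hcount : (e '' Iio ξ).Countable := by
      apply Countable.image
      rw [← le_aleph0_iff_set_countable, mk_Iio_ordinal, lift_le_aleph0]
      rw [lt_omega_iff_card_lt, ← succ_aleph0, Order.lt_succ_iff] at hξ
      exact hξ
    have hlt : ∀ s ∈ e '' Iio ξ, s < b x := by
      rintro _ ⟨η, hη, rfl⟩
      exact he η (lt_trans hη hξ)
    obtain ⟨r₁, hr₁, hr₁U⟩ := exists_pathNhd_subset (T := T) (E := E)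
      (isClopen_setOf_lt (b := b) (b x)).compl.isOpen hy.1 hl hE
    obtain ⟨c, hcx, hcs⟩ := exists_forall_lt_of_not_countablyCofinal hc hcount hlt
    obtain ⟨d, hd, hd'⟩ := exists_isLUB (S := e '' Iio ξ)
      (fun s hs t ht _ => le_total_of_le (hlt s hs).le (hlt t ht).le)
      ⟨(b x).dom, by rintro _ ⟨s, hs, rfl⟩; exact (hlt s hs).le.1⟩
    have hdx : d < b x := (hd.2 fun s hs => (hcs s hs).le).trans_lt hcx
    have hdT : d ∈ T := (show b x ∈ pathClosure T from hr ▸ mem_range_self x) d hdx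
    have hdy : d ≤ b y := hd.2 (by rintro _ ⟨η, hη, rfl⟩; exact (hy.2 η hη).le)
    have hdy' : d < b y := by
      refine lt_of_le_of_ne hdy ?_
      rintro rfl
      refine hl.2.elim (fun h => h hdT) fun h => h ⟨_, hcount, ?_, fun r hr => ?_⟩
      · rintro _ ⟨η, hη, rfl⟩
        exact hy.2 η hη
      · obtain ⟨s, hs, h⟩ := hd' r hr
        exact ⟨s, hs, h.le⟩
    have hsub : ∀ z, d < b z → ∀ η < ξ, e η < b z := fun z hz η hη =>
      (hd.1 ⟨η, hη, rfl⟩).trans_lt hz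
    -- The longer of `d` and `r₁` gives a neighbourhood satisfying both requirements.
    rcases le_total_of_le hr₁.le hdy with h | h
    · exact ⟨d, hdy', fun z hz => ⟨hr₁U (pathNhd_anti b y h hz), hsub z hz.1⟩⟩
    · exact ⟨r₁, hr₁, fun z hz => ⟨hr₁U hz, hsub z (h.trans_lt hz.1)⟩⟩
  · ext y
    simp only [mem_ofPred_eq, mem_iInter]
    refine ⟨fun h β hβ => ⟨h.1, fun η hη => h.2 η (hη.trans hβ)⟩, fun h => ?_⟩
    have h0 : 0 < ξ := pos_iff_ne_zero.2 hlξ.ne_bot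
    exact ⟨(h 0 h0).1, fun η hη => (h _ (hlξ.succ_lt hη)).2 η (Order.lt_succ η)⟩
  · ext y
    simp only [mem_ofPred_eq, mem_iInter, mem_singleton_iff]
    constructor
    · intro h
      have hle : b x ≤ b y := by
        refine le_of_forall_lt_le hlim fun r hr => ?_
        obtain ⟨η, hη, h'⟩ := hcof r hr
        exact h'.trans ((h _ ((isSuccLimit_omega 1).succ_lt hη)).2 η (Order.lt_succ η)).le
      by_contra hne
      exact (h 0 (Ordinal.omega_pos 1)).1 (lt_of_le_of_ne hle fun h' => hne (hb h'.symm))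
    · rintro rfl ξ hξ
      exact ⟨lt_irrefl _, fun η hη => he η (hη.trans hξ)⟩

end Character

/-! ### Binary systems and their limits -/

/-- The list of the first `n` values of `f`, the last one first. -/
def revInit (f : ℕ → Bool) : ℕ → List Bool
  | 0 => []
  | n + 1 => f n :: revInit f n

theorem length_revInit (f : ℕ → Bool) (n : ℕ) : (revInit f n).length = n := by
  induction n with
  | zero => rfl
  | succ n ih => simp [revInit, ih]

theorem revInit_congr {f g : ℕ → Bool} {n : ℕ} (h : ∀ k < n, f k = g k) :
    revInit f n = revInit g n := by
  induction n with
  | zero => rfl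
  | succ n ih =>
    simp only [revInit]
    rw [h n (Nat.lt_succ_self n), ih fun k hk => h k (hk.trans (Nat.lt_succ_self n))]

/-- A copy of the full binary tree `2^{<ω}` in `T`, all of whose paths have length `δ`. -/
structure IsBinarySystem (T : Set BinSeq.{u}) (δ : Ordinal.{u}) (C : List Bool → BinSeq.{u}) :
    Prop where
  mem : ∀ σ, C σ ∈ T
  le_cons : ∀ i σ, C σ ≤ C (i :: σ)
  incompatible : ∀ σ u, C (false :: σ) ≤ u → ¬ C (true :: σ) ≤ u
  dom_lt : ∀ σ, (C σ).dom < δ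
  cofinal : ∀ f, ∀ β < δ, ∃ n, β ≤ (C (revInit f n)).dom

namespace IsBinarySystem

variable {T : Set BinSeq.{u}} {δ : Ordinal.{u}} {C : List Bool → BinSeq.{u}}

theorem lt_cons (hC : IsBinarySystem T δ C) (i : Bool) (σ : List Bool) : C σ < C (i :: σ) := by
  refine lt_of_le_of_ne (hC.le_cons i σ) fun h => ?_
  cases i
  · exact hC.incompatible σ _ (h ▸ hC.le_cons true σ) le_rfl
  · exact hC.incompatible σ _ le_rfl (h ▸ hC.le_cons false σ)

theorem strictMono (hC : IsBinarySystem T δ C) (f : ℕ → Bool) :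
    StrictMono fun n => C (revInit f n) :=
  strictMono_nat_of_lt_succ fun _ => hC.lt_cons _ _

/-- At the first disagreement the two paths would pass through the two incompatible successors of
one node, both below `u`. -/
theorem eq_of_le {f g : ℕ → Bool} (hC : IsBinarySystem T δ C) {m n : ℕ} {u : BinSeq.{u}}
    (hf : C (revInit f m) ≤ u) (hg : C (revInit g n) ≤ u) {k : ℕ} (hm : k < m) (hn : k < n) :
    f k = g k := by
  induction k using Nat.strong_induction_on with
  | _ k ih =>
    have hfg : revInit f k = revInit g k :=
      revInit_congr fun j hj => ih j hj (hj.trans hm) (hj.trans hn)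
    have hf' : C (f k :: revInit f k) ≤ u := ((hC.strictMono f).monotone hm).trans hf
    have hg' : C (g k :: revInit g k) ≤ u := ((hC.strictMono g).monotone hn).trans hg
    rw [← hfg] at hg'
    cases h₁ : f k <;> cases h₂ : g k <;> rw [h₁] at hf' <;> rw [h₂] at hg'
    · exact absurd hg' (hC.incompatible _ _ hf')
    · exact absurd hf' (hC.incompatible _ _ hg')

theorem exists_limit (hC : IsBinarySystem T δ C) (f : ℕ → Bool) :
    ∃ p : BinSeq.{u}, IsLUB (range fun n => C (revInit f n)) p ∧
      ∀ r < p, ∃ n, r < C (revInit f n) := by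
  obtain ⟨p, hp, hp'⟩ := exists_isLUB (S := range fun n => C (revInit f n))
    (hC.strictMono f).monotone.isChain_range
    ⟨δ, by rintro _ ⟨_, ⟨n, rfl⟩, rfl⟩; exact (hC.dom_lt _).le⟩
  refine ⟨p, hp, fun r hr => ?_⟩
  obtain ⟨_, ⟨n, rfl⟩, h⟩ := hp' r hr
  exact ⟨n, h⟩

/-- The union of the path of `C` given by `f`. -/
noncomputable def limit (hC : IsBinarySystem T δ C) (f : ℕ → Bool) : BinSeq.{u} :=
  (hC.exists_limit f).choose

theorem isLUB_limit (hC : IsBinarySystem T δ C) (f : ℕ → Bool) :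
    IsLUB (range fun n => C (revInit f n)) (hC.limit f) :=
  (hC.exists_limit f).choose_spec.1

theorem exists_lt_of_lt_limit (hC : IsBinarySystem T δ C) {f : ℕ → Bool} {r : BinSeq.{u}}
    (h : r < hC.limit f) : ∃ n, r < C (revInit f n) :=
  (hC.exists_limit f).choose_spec.2 r h

theorem lt_limit (hC : IsBinarySystem T δ C) (f : ℕ → Bool) (n : ℕ) :
    C (revInit f n) < hC.limit f :=
  (hC.strictMono f (Nat.lt_succ_self n)).trans_le ((hC.isLUB_limit f).1 ⟨n + 1, rfl⟩)

theorem dom_limit (hC : IsBinarySystem T δ C) (f : ℕ → Bool) : (hC.limit f).dom = δ := by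
  apply le_antisymm
  · by_contra! h
    obtain ⟨r, hr, hd⟩ := exists_lt_dom_eq _ h
    obtain ⟨n, hn⟩ := hC.exists_lt_of_lt_limit hr
    exact (dom_lt_of_lt hn).not_gt (hd ▸ hC.dom_lt _)
  · by_contra! h
    obtain ⟨n, hn⟩ := hC.cofinal f _ h
    exact (dom_lt_of_lt (hC.lt_limit f n)).not_ge hn

theorem isSuccLimit_dom_limit (hC : IsBinarySystem T δ C) (f : ℕ → Bool) :
    Order.IsSuccLimit (hC.limit f).dom := by
  refine Ordinal.isSuccLimit_iff.2
    ⟨(pos_of_gt (dom_lt_of_lt (hC.lt_limit f 0))).ne', fun β hβ => ?_⟩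
  obtain ⟨r, hr, rfl⟩ := exists_lt_dom_eq _ hβ.lt
  obtain ⟨n, hn⟩ := hC.exists_lt_of_lt_limit hr
  exact hβ.2 (dom_lt_of_lt hn) (dom_lt_of_lt (hC.lt_limit f n))

theorem limit_mem_pathClosure (hC : IsBinarySystem T δ C) (hT : ∀ s ∈ T, ∀ t ≤ s, t ∈ T)
    (f : ℕ → Bool) : hC.limit f ∈ pathClosure T := fun _ hr => by
  obtain ⟨n, hn⟩ := hC.exists_lt_of_lt_limit hr
  exact hT _ (hC.mem _) _ hn.le

theorem limit_injective (hC : IsBinarySystem T δ C) : Function.Injective hC.limit := by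
  intro f g h
  funext k
  exact hC.eq_of_le (hC.lt_limit f (k + 1)).le (h ▸ (hC.lt_limit g (k + 1)).le)
    (Nat.lt_succ_self k) (Nat.lt_succ_self k)

end IsBinarySystem

/-! ### Cantor trees from binary systems -/

/-- The values of a sequence at the natural numbers, extended by `false`. -/
noncomputable def BinSeq.natVal (s : BinSeq.{u}) (n : ℕ) : Bool :=
  open Classical in if h : (n : Ordinal.{u}) < s.dom then s.val ⟨n, h⟩ else false

theorem BinSeq.natVal_eq_of_le {s t : BinSeq.{u}} (h : s ≤ t) {n : ℕ}
    (hn : (n : Ordinal.{u}) < s.dom) : s.natVal n = t.natVal n := by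
  have hn' : (n : Ordinal.{u}) < t.dom := hn.trans_le h.1
  simp only [BinSeq.natVal, hn, hn', dif_pos]
  exact h.2 ⟨n, hn⟩

theorem BinSeq.le_of_natVal_eq {s t : BinSeq.{u}} (hs : s.dom ≤ Ordinal.omega0)
    (hd : s.dom ≤ t.dom)
    (h : ∀ n : ℕ, (n : Ordinal.{u}) < s.dom → s.natVal n = t.natVal n) : s ≤ t := by
  refine ⟨hd, fun β => ?_⟩
  obtain ⟨β, hβ⟩ := β
  have hβ : β < s.dom := hβ
  obtain ⟨n, rfl⟩ := Ordinal.lt_omega0.1 (hβ.trans_le hs)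
  have := h n hβ
  simp only [BinSeq.natVal, hβ, hβ.trans_le hd, dif_pos] at this
  exact this

/-- A finite sequence is sent to the node of `C` with that address, a sequence of length `ω` to the
limit of the corresponding path. Incompatibility of siblings makes this reflect the order. -/
theorem IsBinarySystem.containsCantorTree {T : Set BinSeq.{u}} {δ : Ordinal.{u}}
    {C : List Bool → BinSeq.{u}} (hC : IsBinarySystem T δ C) (h : ∀ f, hC.limit f ∈ T) :
    ContainsCantorTree T := by
  classical
  have hfin : ∀ s : BinSeq.{u}, s.dom < Ordinal.omega0 → ∃ n : ℕ, s.dom = n := fun s hs =>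
    Ordinal.lt_omega0.1 hs
  choose! len hlen using hfin
  let Φ : BinSeq.{u} → BinSeq.{u} := fun s =>
    if s.dom < Ordinal.omega0 then C (revInit s.natVal (len s)) else hC.limit s.natVal
  have hΦT : ∀ s, Φ s ∈ T := fun s => by
    by_cases hs : s.dom < Ordinal.omega0
    · simpa [Φ, hs] using hC.mem _
    · simpa [Φ, hs] using h _
  have hlow : ∀ (s : BinSeq.{u}) (n : ℕ), (n : Ordinal.{u}) ≤ s.dom →
      C (revInit s.natVal n) ≤ Φ s := fun s n hn => by
    by_cases hs : s.dom < Ordinal.omega0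
    · simp only [Φ, hs, if_true]
      rw [hlen s hs] at hn
      exact (hC.strictMono _).monotone (by exact_mod_cast hn)
    · simpa [Φ, hs] using (hC.lt_limit _ n).le
  have hlt : ∀ s t : BinSeq.{u}, t.dom ≤ Ordinal.omega0 → s < t → Φ s < Φ t := by
    intro s t ht hst
    have hd := dom_lt_of_lt hst
    have hs := hd.trans_le ht
    have hle : Order.succ s.dom ≤ t.dom := Order.succ_le_of_lt hd
    rw [hlen s hs] at hle hd
    have h₁ : Φ s = C (revInit t.natVal (len s)) := by
      simp only [Φ, hs, if_true]
      rw [revInit_congr fun k hk => ?_]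
      refine natVal_eq_of_le hst.le ?_
      rw [hlen s hs]
      exact_mod_cast hk
    rw [h₁]
    exact (hC.strictMono _ (Nat.lt_succ_self _)).trans_le (hlow t _ (by simpa using hle))
  have hle : ∀ s t : BinSeq.{u}, s.dom ≤ Ordinal.omega0 → t.dom ≤ Ordinal.omega0 →
      Φ s ≤ Φ t → s ≤ t := by
    intro s t hs ht hst
    have hag : ∀ n : ℕ, (n : Ordinal.{u}) < s.dom → (n : Ordinal.{u}) < t.dom →
        s.natVal n = t.natVal n := fun n h₁ h₂ => by
      refine hC.eq_of_le (m := n + 1) (n := n + 1) ((hlow s _ ?_).trans hst) (hlow t _ ?_)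
        (Nat.lt_succ_self n) (Nat.lt_succ_self n)
      · simpa using Order.succ_le_of_lt h₁
      · simpa using Order.succ_le_of_lt h₂
    rcases le_or_gt s.dom t.dom with hd | hd
    · exact le_of_natVal_eq hs hd fun n hn => hag n hn (hn.trans_le hd)
    · have hts : t < s := lt_of_le_of_ne
        (le_of_natVal_eq ht hd.le fun n hn => (hag n (hn.trans hd) hn).symm)
        fun h' => hd.ne (congrArg dom h')
      exact absurd hst (hlt t s hs hts).not_ge
  have hmono : ∀ s t : cantorTree.{u}, Φ s ≤ Φ t ↔ s ≤ t := fun s t => by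
    refine ⟨hle s t s.2 t.2, fun hst => ?_⟩
    rcases hst.eq_or_lt with rfl | hst
    · exact le_rfl
    · exact (hlt s t t.2 hst).le
  refine ⟨range fun s : cantorTree.{u} => Φ s, ?_, ⟨?_⟩⟩
  · rintro _ ⟨s, rfl⟩
    exact hΦT s
  · refine ⟨Equiv.ofInjective (fun s : cantorTree.{u} => Φ s) fun s t hst => ?_, ?_⟩
    · exact le_antisymm ((hmono s t).1 hst.le) ((hmono t s).1 hst.ge)
    · intro s t
      exact hmono s t

/-! ### Continuum many limits outside the tree -/

/-- Insert the values of `g` into a list of values. -/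
def interleaveList (g : ℕ → Bool) : List Bool → List Bool
  | [] => []
  | i :: σ => i :: g σ.length :: interleaveList g σ

/-- Alternate between the values of `g` and those of `f`. -/
def interleaveSeq (g f : ℕ → Bool) (n : ℕ) : Bool :=
  if n % 2 = 0 then g (n / 2) else f (n / 2)

theorem revInit_interleaveSeq (g f : ℕ → Bool) (n : ℕ) :
    revInit (interleaveSeq g f) (2 * n) = interleaveList g (revInit f n) := by
  induction n with
  | zero => rfl
  | succ n ih =>
    have h₁ : interleaveSeq g f (2 * n + 1) = f n := by
      simp [interleaveSeq, Nat.add_mod, show (2 * n + 1) / 2 = n by omega]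
    have h₂ : interleaveSeq g f (2 * n) = g n := by simp [interleaveSeq]
    rw [show 2 * (n + 1) = 2 * n + 1 + 1 by ring]
    simp only [revInit, interleaveList, h₁, h₂, ih, length_revInit]

theorem IsBinarySystem.interleave {T : Set BinSeq.{u}} {δ : Ordinal.{u}}
    {C : List Bool → BinSeq.{u}} (hC : IsBinarySystem T δ C) (g : ℕ → Bool) :
    IsBinarySystem T δ (C ∘ interleaveList g) where
  mem _ := hC.mem _
  le_cons _ _ := (hC.le_cons _ _).trans (hC.le_cons _ _)
  incompatible _ u := hC.incompatible _ u
  dom_lt _ := hC.dom_lt _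
  cofinal f β hβ := by
    obtain ⟨n, hn⟩ := hC.cofinal (interleaveSeq g f) β hβ
    refine ⟨n, hn.trans ?_⟩
    rw [Function.comp_apply, ← revInit_interleaveSeq]
    exact ((hC.strictMono _).monotone (by omega)).1

theorem IsBinarySystem.limit_interleave {T : Set BinSeq.{u}} {δ : Ordinal.{u}}
    {C : List Bool → BinSeq.{u}} (hC : IsBinarySystem T δ C) (g f : ℕ → Bool) :
    (hC.interleave g).limit f = hC.limit (interleaveSeq g f) := by
  refine eq_of_le_of_dom_eq (((hC.interleave g).isLUB_limit f).2 ?_) ?_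
  · rintro _ ⟨n, rfl⟩
    simp only [Function.comp_apply]
    rw [← revInit_interleaveSeq]
    exact (hC.lt_limit _ _).le
  · rw [dom_limit, dom_limit]

/-- Fixing every other turn by `g` leaves a binary subsystem, one of whose limits is outside `T`
since `T` has no Cantor subtree. Different `g` give different limits. -/
theorem IsBinarySystem.continuum_le_mk {T : Set BinSeq.{u}} {δ : Ordinal.{u}}
    {C : List Bool → BinSeq.{u}} (hC : IsBinarySystem T δ C) (hT : ¬ ContainsCantorTree T) :
    𝔠 ≤ #(range hC.limit \ T : Set BinSeq.{u}) := by
  have h : ∀ g, ∃ f, hC.limit (interleaveSeq g f) ∉ T := fun g => by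
    by_contra! H
    exact hT ((hC.interleave g).containsCantorTree fun f => hC.limit_interleave g f ▸ H f)
  choose F hF using h
  have hinj : Function.Injective fun g : ℕ → Bool =>
      (⟨hC.limit (interleaveSeq g (F g)), ⟨_, rfl⟩, hF g⟩ :
        (range hC.limit \ T : Set BinSeq.{u})) := by
    intro g g' hgg
    have := hC.limit_injective
      (congrArg (fun z : (range hC.limit \ T : Set BinSeq.{u}) => z.1) hgg)
    funext n
    -- The even positions of the interleaved sequence recover `g`.
    simpa [interleaveSeq] using congrFun this (2 * n)
  have := lift_mk_le_lift_mk_of_injective hinj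
  rwa [mk_pi, prod_const, mk_bool, mk_nat, lift_id, lift_id, two_power_aleph0,
    lift_continuum, lift_uzero] at this

/-! ### Simultaneous splitting -/

/-- Recursion along a well-order of `ι` of least possible type: before each stage fewer than `κ`
values are used, so they cannot exhaust `Q i`. -/
theorem exists_injective_choice {ι α : Type u} {κ : Cardinal.{u}} (hι : #ι ≤ κ)
    (Q : ι → Set α) (hQ : ∀ i, κ ≤ #(Q i)) :
    ∃ F : ι → α, Function.Injective F ∧ ∀ i, F i ∈ Q i := by
  obtain ⟨r, _, hr⟩ := Cardinal.exists_ord_eq ι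
  have hex : ∀ (i : ι) (g : ∀ j, r j i → α), ∃ x ∈ Q i, ∀ j h, g j h ≠ x := by
    intro i g
    by_contra! H
    have hsub : Q i ⊆ range fun j : {j // r j i} => g j.1 j.2 := fun x hx => by
      obtain ⟨j, h, hj⟩ := H x hx
      exact ⟨⟨j, h⟩, hj⟩
    have h₁ : #{j // r j i} < #ι := by
      rw [← Ordinal.card_typein, ← lt_ord, hr]
      exact Ordinal.typein_lt_type r i
    exact ((hι.trans (hQ i)).trans ((mk_le_mk_of_subset hsub).trans mk_range_le)).not_gt h₁
  choose next hnext hne using hex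
  have hwf : WellFounded r := IsWellFounded.wf
  let F : ι → α := hwf.fix next
  have hF : ∀ i, F i = next i fun j _ => F j := fun i => hwf.fix_eq next i
  have hFne : ∀ i j, r j i → F j ≠ F i := fun i j hji => by
    rw [hF i]
    exact hne i (fun j _ => F j) j hji
  refine ⟨F, fun i j hij => ?_, fun i => by rw [hF i]; exact hnext i _⟩
  rcases trichotomous_of r i j with h | h | h
  · exact absurd hij (hFne j i h)
  · exact h
  · exact absurd hij.symm (hFne i j h)

/-- At most `κ` sets of size at least `κ` can be split simultaneously. -/
theorem exists_splitting_set {ι α : Type u} {κ : Cardinal.{u}} (hκ : ℵ₀ ≤ κ) (hι : #ι ≤ κ)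
    (Q : ι → Set α) (hQ : ∀ i, κ ≤ #(Q i)) :
    ∃ E : Set α, ∀ i, (Q i ∩ E).Nonempty ∧ (Q i \ E).Nonempty := by
  -- Two distinct points are picked from each set, one to go into `E` and one to stay outside.
  obtain ⟨F, hF, hFQ⟩ := exists_injective_choice (ι := ι × Bool) (κ := κ)
    (by
      rw [mk_prod]
      simpa using mul_le_of_le hκ hι ((natCast_lt_aleph0 (n := 2)).le.trans hκ))
    (fun i => Q i.1) (fun i => hQ i.1)
  refine ⟨range fun i => F (i, true), fun i => ⟨⟨F (i, true), hFQ (i, true), ⟨i, rfl⟩⟩,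
    ⟨F (i, false), hFQ (i, false), ?_⟩⟩⟩
  rintro ⟨j, hj⟩
  simpa using hF hj

theorem card_le_aleph_one_of_lt_omega_two {δ : Ordinal.{u}} (hδ : δ < Ordinal.omega 2) :
    δ.card ≤ ℵ_ 1 := by
  rw [lt_omega_iff_card_lt, ← one_add_one_eq_two, ← succ_aleph,
    Order.lt_succ_iff] at hδ
  exact hδ

/-- For every `δ < ω₂` the limits of binary systems of height `δ` that are outside `T` can be split
so that every system has limits in both parts. -/
theorem exists_splitting_limits {T : Set BinSeq.{u}} (hCH : (𝔠 : Cardinal.{u}) = ℵ_ 1)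
    (hlevel : ∀ β : Ordinal.{u}, #(treeLevel T β) ≤ ℵ_ 1) (hcantor : ¬ ContainsCantorTree T)
    {δ : Ordinal.{u}} (hδ : δ < Ordinal.omega 2) :
    ∃ E : Set BinSeq.{u}, ∀ (C : List Bool → BinSeq.{u}) (hC : IsBinarySystem T δ C),
      (∃ f, hC.limit f ∉ T ∧ hC.limit f ∈ E) ∧ ∃ f, hC.limit f ∉ T ∧ hC.limit f ∉ E := by
  have hCH' : (𝔠 : Cardinal.{u + 1}) = ℵ_ 1 := by
    rw [← lift_continuum.{u + 1, u}, hCH]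
    simp
  -- There are at most `ω₁` levels below `δ < ω₂`, each of size at most `ω₁`.
  have hlow : #{t // t ∈ T ∧ t.dom < δ} ≤ 𝔠 := by
    have hsub : {t | t ∈ T ∧ t.dom < δ} ⊆ ⋃ β : Iio δ, treeLevel T β :=
      fun t ht => mem_iUnion.2 ⟨⟨t.dom, ht.2⟩, ht.1, rfl⟩
    refine (mk_le_mk_of_subset hsub).trans ((mk_iUnion_le _).trans ?_)
    rw [hCH']
    refine mul_le_of_le (aleph0_le_aleph 1) ?_ (ciSup_le' fun β => hlevel _)
    rw [mk_Iio_ordinal]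
    simpa using lift_le.{u + 1}.2 (card_le_aleph_one_of_lt_omega_two hδ)
  -- A system is a map from a countable set into the nodes below `δ`, and `𝔠 ^ ℵ₀ = 𝔠`.
  have hcard : #{C : List Bool → BinSeq.{u} // IsBinarySystem T δ C} ≤ 𝔠 := by
    have hinj : Function.Injective
        fun (C : {C : List Bool → BinSeq.{u} // IsBinarySystem T δ C}) (σ : List Bool) =>
          (⟨C.1 σ, C.2.mem σ, C.2.dom_lt σ⟩ : {t // t ∈ T ∧ t.dom < δ}) := fun C D h => by
      apply Subtype.ext
      funext σ
      exact congrArg Subtype.val (congrFun h σ)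
    refine (mk_le_of_injective hinj).trans ?_
    rw [mk_pi]
    simp only [prod_const]
    refine (power_le_power_right (by simpa using hlow)).trans ?_
    simp
  obtain ⟨E, hE⟩ := exists_splitting_set aleph0_le_continuum hcard
    (fun C => range C.2.limit \ T) fun C => C.2.continuum_le_mk hcantor
  refine ⟨E, fun C hC => ?_⟩
  obtain ⟨⟨_, ⟨⟨f, rfl⟩, hf⟩, hfE⟩, ⟨_, ⟨⟨g, rfl⟩, hg⟩, hgE⟩⟩ := hE ⟨C, hC⟩
  exact ⟨⟨f, hf, hfE⟩, ⟨g, hg, hgE⟩⟩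

/-! ### The Lindelöf property -/

/-- Countably many members of the family `U` cover `A`. -/
def CountablyCovered {ι X : Type*} (U : ι → Set X) (A : Set X) : Prop :=
  ∃ t : Set ι, t.Countable ∧ A ⊆ ⋃ i ∈ t, U i

namespace CountablyCovered

variable {ι X : Type*} {U : ι → Set X} {A B : Set X}

theorem mono (h : A ⊆ B) : CountablyCovered U B → CountablyCovered U A
  | ⟨t, ht, hB⟩ => ⟨t, ht, h.trans hB⟩

theorem biUnion {κ : Type*} {S : Set κ} (hS : S.Countable) {A : κ → Set X}
    (h : ∀ k ∈ S, CountablyCovered U (A k)) : CountablyCovered U (⋃ k ∈ S, A k) := by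
  choose! t ht hA using h
  refine ⟨⋃ k ∈ S, t k, hS.biUnion ht, iUnion₂_subset fun k hk => (hA k hk).trans ?_⟩
  exact biUnion_subset_biUnion_left (subset_biUnion_of_mem (u := t) hk)

theorem union (hA : CountablyCovered U A) (hB : CountablyCovered U B) :
    CountablyCovered U (A ∪ B) := by
  obtain ⟨s, hs, hA⟩ := hA
  obtain ⟨t, ht, hB⟩ := hB
  exact ⟨s ∪ t, hs.union ht, union_subset
    (hA.trans (biUnion_subset_biUnion_left subset_union_left))
    (hB.trans (biUnion_subset_biUnion_left subset_union_right))⟩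

theorem of_subset {i : ι} (h : A ⊆ U i) : CountablyCovered U A :=
  ⟨{i}, countable_singleton i, by simpa using h⟩

theorem of_subsingleton (hU : ⋃ i, U i = Set.univ) (hA : A.Subsingleton) :
    CountablyCovered U A := by
  rcases hA.eq_empty_or_singleton with rfl | ⟨x, rfl⟩
  · exact ⟨∅, countable_empty, empty_subset _⟩
  · obtain ⟨i, hi⟩ := mem_iUnion.1 (hU ▸ mem_univ x)
    exact of_subset (i := i) (by simpa using hi)

end CountablyCovered

section

variable {ι : Type*} {X : Type u} {T E : Set BinSeq.{u}} {b : X → BinSeq.{u}} {U : ι → Set X}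

theorem subsingleton_setOf_eq (hb : Function.Injective b) (s : BinSeq.{u}) :
    {y | b y = s}.Subsingleton :=
  fun _ hy _ hz => hb (hy.trans (Eq.symm hz))

/-- The splitting property of the nodes above which no countable subfamily is a cover. -/
theorem exists_incompatible_of_not_countablyCovered (hb : Function.Injective b)
    (hr : range b = pathClosure T) {κ : Ordinal.{u}} (hκ : ∀ s ∈ pathClosure T, s.dom ≤ κ)
    (hE : ∀ x ∈ E, x.CountablyCofinal)
    (hUo : ∀ i, IsOpen[branchTopology T E b] (U i)) (hU : ⋃ i, U i = Set.univ) {t : BinSeq.{u}}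
    (ht : ¬ CountablyCovered U {y | t ≤ b y}) :
    ∃ p q, t ≤ p ∧ t ≤ q ∧ ¬ CountablyCovered U {y | p ≤ b y} ∧
      ¬ CountablyCovered U {y | q ≤ b y} ∧ ¬ p ≤ q ∧ ¬ q ≤ p := by
  by_contra! H
  set Bad : Set BinSeq.{u} := {s | t ≤ s ∧ ¬ CountablyCovered U {y | s ≤ b y}}
  have hmem : ∀ x, b x ∈ pathClosure T := fun x => hr ▸ mem_range_self x
  have hbelow : ∀ s ∈ Bad, ∃ x, s ≤ b x := fun s hs => by
    by_contra! h
    exact hs.2 (.of_subsingleton hU fun y hy => absurd hy (h y))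
  have hchain : IsChain (· ≤ ·) Bad := fun p hp q hq _ => by
    by_contra! h
    exact h.2 (H p q hp.1 hq.1 hp.2 hq.2 h.1)
  obtain ⟨c, hc, hc'⟩ := exists_isLUB hchain ⟨κ, by
    rintro _ ⟨s, hs, rfl⟩
    obtain ⟨x, hx⟩ := hbelow s hs
    exact hx.1.trans (hκ _ (hmem x))⟩
  have htc : t ≤ c := hc.1 ⟨le_rfl, ht⟩
  have hgood : ∀ s, t ≤ s → ¬ s ≤ c → CountablyCovered U {y | s ≤ b y} := fun s hs hsc => by
    by_contra h
    exact hsc (hc.1 ⟨hs, h⟩)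
  have hW : ∀ d : BinSeq.{u}, t ≤ d → d ≤ c →
      CountablyCovered U {y | t ≤ b y ∧ ¬ d ≤ b y} := by
    intro d
    induction hd : d.dom using WellFoundedLT.induction generalizing d with
    | _ β ih =>
    subst hd
    intro htd hdc
    rcases htd.eq_or_lt with rfl | htd'
    · exact .of_subsingleton hU fun y hy => absurd hy.1 hy.2
    have ih' : ∀ r < d, t ≤ r → CountablyCovered U {y | t ≤ b y ∧ ¬ r ≤ b y} :=
      fun r hrd htr => ih r.dom (dom_lt_of_lt hrd) r rfl htr (hrd.le.trans hdc)
    by_cases hlim : Order.IsSuccLimit d.dom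
    · by_cases hcc : d.CountablyCofinal
      · obtain ⟨S, hS, hlt, hcof⟩ := hcc
        refine (CountablyCovered.biUnion (S := {s ∈ S | t ≤ s})
          (hS.mono (sep_subset _ _)) fun s hs => ih' s (hlt s hs.1) hs.2).mono ?_
        rintro y ⟨hty, hdy⟩
        obtain ⟨r, hrd, hry⟩ := exists_lt_not_le hlim hdy
        obtain ⟨s, hs, hrs⟩ := hcof r hrd
        have hsy : ¬ s ≤ b y := fun h => hry (hrs.trans h)
        refine mem_iUnion₂.2 ⟨s, ⟨hs, ?_⟩, hty, hsy⟩
        by_contra hts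
        exact hsy ((lt_of_not_le htd (hlt s hs).le hts).le.trans hty)
      · have hdP : d ∈ range b := by
          rw [hr]
          intro r hrd
          obtain ⟨m, hrm, hmd⟩ := exists_between hlim hrd
          obtain ⟨s, hs, hms⟩ := hc' m (hmd.trans_le hdc)
          obtain ⟨x, hx⟩ := hbelow s hs
          exact hmem x r (hrm.trans (hms.trans_le hx))
        obtain ⟨x, rfl⟩ := hdP
        obtain ⟨i, hi⟩ := mem_iUnion.1 (hU ▸ mem_univ x)
        obtain ⟨r, hrx, hrU⟩ := exists_pathNhd_subset (hUo i) hi ⟨hlim, .inr hcc⟩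
          fun h => hcc (hE _ h)
        obtain ⟨s, hsx, hts, hrs⟩ : ∃ s < b x, t ≤ s ∧ r ≤ s := by
          rcases le_total_of_le hrx.le htd with h | h
          · exact ⟨t, htd', le_rfl, h⟩
          · exact ⟨r, hrx, h, le_rfl⟩
        refine (((ih' s hsx hts).union (.of_subsingleton hU (subsingleton_setOf_eq hb s))).union
          (.of_subset ((pathNhd_anti b x hrs).trans hrU))).mono ?_
        rintro y ⟨hty, hxy⟩
        by_cases hsy : s ≤ b y
        · rcases hsy.eq_or_lt with h | h
          · exact .inl (.inr h.symm)
          · exact .inr ⟨h, fun h' => hxy h'.le⟩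
        · exact .inl (.inl ⟨hty, hsy⟩)
    · have h0 : d.dom ≠ 0 := (pos_of_gt (dom_lt_of_lt htd')).ne'
      have hsucc : ¬ Order.IsSuccPrelimit d.dom := fun h =>
        hlim (Ordinal.isSuccLimit_iff.2 ⟨h0, h⟩)
      rw [Order.not_isSuccPrelimit_iff] at hsucc
      obtain ⟨β, hβ⟩ := hsucc
      obtain ⟨m, hmd, hm⟩ := d.exists_lt_dom_eq hβ.lt
      have htm : t ≤ m := le_of_dom_le htd hmd.le (hm ▸ hβ.le_of_lt (dom_lt_of_lt htd'))
      -- A child of `m` below `c` extends `d` and contributes nothing; a child not below `c` is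
      -- good.
      have hside : ∀ j, CountablyCovered U {y | m.snoc j ≤ b y ∧ ¬ d ≤ b y} := fun j => by
        by_cases hj : m.snoc j ≤ c
        · have : d ≤ m.snoc j := le_of_dom_le hdc hj (by
            have := dom_lt_of_lt (m.lt_snoc j)
            rw [hm] at this
            exact hβ.ge_of_gt this)
          exact .of_subsingleton hU fun y hy => absurd (this.trans hy.1) hy.2
        · exact (hgood _ (htm.trans (m.lt_snoc j).le) hj).mono fun y hy => hy.1
      refine ((((ih' m hmd htm).union (.of_subsingleton hU (subsingleton_setOf_eq hb m))).union
        (hside false)).union (hside true)).mono ?_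
      rintro y ⟨hty, hdy⟩
      by_cases hmy : m ≤ b y
      · rcases hmy.eq_or_lt with h | h
        · exact .inl (.inl (.inr h.symm))
        · obtain ⟨j, hj⟩ := exists_snoc_le h
          cases j
          · exact .inl (.inr ⟨hj, hdy⟩)
          · exact .inr ⟨hj, hdy⟩
      · exact .inl (.inl (.inl ⟨hty, hmy⟩))
  have htop : ∀ j, CountablyCovered U {y | c.snoc j ≤ b y} := fun j =>
    hgood _ (htc.trans (c.lt_snoc j).le) (c.lt_snoc j).not_ge
  refine ht (((((hW c htc le_rfl).union (.of_subsingleton hU (subsingleton_setOf_eq hb c))).union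
    (htop false)).union (htop true)).mono fun y hty => ?_)
  by_cases hcy : c ≤ b y
  · rcases hcy.eq_or_lt with h | h
    · exact .inl (.inl (.inr h.symm))
    · obtain ⟨j, hj⟩ := exists_snoc_le h
      cases j
      · exact .inl (.inr hj)
      · exact .inr hj
  · exact .inl (.inl (.inl ⟨hty, hcy⟩))

end

/-- A nonempty set of nodes in which every node has two incompatible extensions contains a binary
system. -/
theorem exists_isBinarySystem {T Bad : Set BinSeq.{u}} (hBT : Bad ⊆ T) (hne : Bad.Nonempty)
    {κ : Ordinal.{u}} (hκ : ∀ s ∈ T, s.dom < κ)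
    (hsplit : ∀ t ∈ Bad, ∃ p ∈ Bad, ∃ q ∈ Bad, t ≤ p ∧ t ≤ q ∧ ¬ p ≤ q ∧ ¬ q ≤ p) :
    ∃ δ C, IsBinarySystem T δ C ∧ ∀ σ, C σ ∈ Bad := by
  let IsSplitting : Set BinSeq.{u} → Prop := fun S =>
    ∀ t ∈ S, ∃ p ∈ S, ∃ q ∈ S, t ≤ p ∧ t ≤ q ∧ ¬ p ≤ q ∧ ¬ q ≤ p
  -- Minimizing the height bound `δ` of a countable splitting set makes the part above any of its
  -- nodes cofinal in `δ`, since that part is again a countable splitting set. This lets all paths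
  -- reach the same height.
  let Q : Ordinal.{u} → Prop := fun δ => ∃ S : Set BinSeq.{u}, S.Countable ∧ S.Nonempty ∧
    S ⊆ Bad ∧ IsSplitting S ∧ ∀ s ∈ S, s.dom < δ
  have hQ : ∃ δ, Q δ := by
    obtain ⟨t₀, ht₀⟩ := hne
    choose! p hp q hq htp htq hpq hqp using hsplit
    let g : List Bool → BinSeq.{u} := fun σ => σ.foldr (fun i t => if i then p t else q t) t₀
    have hg : ∀ σ, g σ ∈ Bad := fun σ => by
      induction σ with
      | nil => exact ht₀
      | cons i σ ih =>
        cases i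
        · exact hq _ ih
        · exact hp _ ih
    refine ⟨κ, range g, countable_range g, range_nonempty g, ?_, ?_, ?_⟩
    · rintro _ ⟨σ, rfl⟩
      exact hg σ
    · rintro _ ⟨σ, rfl⟩
      exact ⟨_, ⟨true :: σ, rfl⟩, _, ⟨false :: σ, rfl⟩, htp _ (hg σ), htq _ (hg σ), hpq _ (hg σ),
        hqp _ (hg σ)⟩
    · rintro _ ⟨σ, rfl⟩
      exact hκ _ (hBT (hg σ))
  obtain ⟨δ, ⟨S, hSc, hSn, hSB, hS, hSδ⟩, hmin⟩ :=
    WellFounded.has_min (r := ((· < ·) : Ordinal.{u} → Ordinal.{u} → Prop)) wellFounded_lt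
      {δ | Q δ} hQ
  have hcof : ∀ s ∈ S, ∀ β < δ, ∃ s' ∈ S, s ≤ s' ∧ β ≤ s'.dom := by
    intro s hs β hβ
    by_contra! H
    refine hmin β ⟨{s' ∈ S | s ≤ s'}, hSc.mono (sep_subset _ _), ⟨s, hs, le_rfl⟩,
      (sep_subset _ _).trans hSB, ?_, fun s' hs' => H s' hs'.1 hs'.2⟩ hβ
    rintro t ⟨ht, hst⟩
    obtain ⟨p, hp, q, hq, htp, htq, h⟩ := hS t ht
    exact ⟨p, ⟨hp, hst.trans htp⟩, q, ⟨hq, hst.trans htq⟩, htp, htq, h⟩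
  obtain ⟨e, rfl⟩ := hSc.exists_eq_range hSn
  -- At stage `n` both successors are at least as long as the `n`-th node of the countable set, so
  -- every path is cofinal in `δ`.
  have hstep : ∀ (s : range e) (n : ℕ), ∃ p : Bool → range e, (∀ i, s.1 ≤ (p i).1) ∧
      (∀ i, (e n).dom ≤ (p i).1.dom) ∧ ∀ u, (p false).1 ≤ u → ¬ (p true).1 ≤ u := by
    intro s n
    obtain ⟨s', hs', hss', hd⟩ := hcof s s.2 _ (hSδ (e n) ⟨n, rfl⟩)
    obtain ⟨p, hp, q, hq, hsp, hsq, hpq, hqp⟩ := hS s' hs'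
    refine ⟨fun i => if i then ⟨p, hp⟩ else ⟨q, hq⟩, fun i => ?_, fun i => ?_, fun u h₁ h₂ => ?_⟩
    · cases i
      · exact hss'.trans hsq
      · exact hss'.trans hsp
    · cases i
      · exact hd.trans hsq.1
      · exact hd.trans hsp.1
    · exact (le_total_of_le (r := p) (s := q) h₂ h₁).elim hpq hqp
  choose p hsp hd hinc using hstep
  let C : List Bool → range e := List.rec ⟨e 0, ⟨0, rfl⟩⟩ fun i σ s => p s σ.length i
  refine ⟨δ, fun σ => (C σ).1, ⟨fun σ => hBT (hSB (C σ).2), fun i σ => hsp _ _ _,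
    fun σ u => hinc _ _ u, fun σ => hSδ _ (C σ).2, fun f β hβ => ?_⟩, fun σ => hSB (C σ).2⟩
  obtain ⟨_, ⟨n, rfl⟩, -, hn⟩ := hcof (e 0) ⟨0, rfl⟩ β hβ
  refine ⟨n + 1, hn.trans ?_⟩
  have := hd (C (revInit f n)) (revInit f n).length (f n)
  rw [length_revInit] at this
  refine this.trans (le_of_eq ?_)
  simp only [C, revInit, length_revInit]

theorem lindelofSpace_branchTopology {X : Type u} {T E : Set BinSeq.{u}} {b : X → BinSeq.{u}}
    (hb : Function.Injective b) (hr : range b = pathClosure T)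
    (hT : ∀ s ∈ T, ∀ t ≤ s, t ∈ T)
    {κ : Ordinal.{u}} (hκ : ∀ s ∈ pathClosure T, s.dom < κ)
    (hE : ∀ x ∈ E, x.CountablyCofinal)
    (hsys : ∀ δ C (hC : IsBinarySystem T δ C), ∃ f, hC.limit f ∉ T ∧ hC.limit f ∉ E) :
    @LindelofSpace X (branchTopology T E b) := by
  let _ := branchTopology T E b
  refine ⟨isLindelof_of_countable_subcover fun {ι} U hUo hU => ?_⟩
  have hU' : ⋃ i, U i = Set.univ := univ_subset_iff.1 hU
  change CountablyCovered U Set.univ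
  by_contra hbad
  have hmem : ∀ x, b x ∈ pathClosure T := fun x => hr ▸ mem_range_self x
  have hTP : T ⊆ pathClosure T := fun s hs r hrs => hT s hs r hrs.le
  obtain ⟨δ, C, hC, hCB⟩ := exists_isBinarySystem (T := T)
    -- Bad nodes are in `T`: outside `T` the cone contains at most the node itself.
    (Bad := {s | ¬ CountablyCovered U {y | s ≤ b y}}) (fun s hs => by
      by_contra hsT
      refine hs (.of_subsingleton hU' ((subsingleton_setOf_eq hb s).anti fun y hy => ?_))
      by_contra hne
      exact hsT (hmem y s (lt_of_le_of_ne hy fun h => hne h.symm)))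
    ⟨nil, by simpa [nil_le] using hbad⟩ (fun s hs => hκ s (hTP hs)) (fun t ht => by
      obtain ⟨p, q, htp, htq, hp, hq, h⟩ := exists_incompatible_of_not_countablyCovered hb hr
        (fun s hs => (hκ s hs).le) hE hUo hU' ht
      exact ⟨p, hp, q, hq, htp, htq, h⟩)
  obtain ⟨f, hfT, hfE⟩ := hsys δ C hC
  have hf : hC.limit f ∈ range b := hr ▸ hC.limit_mem_pathClosure hT f
  obtain ⟨x, hx⟩ := hf
  obtain ⟨i, hi⟩ := mem_iUnion.1 (hU' ▸ mem_univ x)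
  obtain ⟨r, hrx, hrU⟩ := exists_pathNhd_subset (hUo i) hi
    ⟨hx ▸ hC.isSuccLimit_dom_limit f, .inl (hx ▸ hfT)⟩ (hx ▸ hfE)
  obtain ⟨n, hn⟩ := hC.exists_lt_of_lt_limit (hx ▸ hrx)
  refine hCB (revInit f n) (.of_subset (i := i) (Subset.trans (fun y hy => ?_) hrU))
  -- As the limit is not in `T`, no point is properly above it, so its basic neighbourhood contains
  -- the full cone above a node of the path.
  exact ⟨hn.trans_le hy, fun h => hfT (hx ▸ hmem y _ h)⟩

/-! ### Lengths and cardinality of the set of points -/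

/-- The initial segments in `T` of a point of length at least `ω₂` would meet every level below
`ω₂`, hence form a branch of size `ω₂`. -/
theorem dom_lt_omega_two_of_mem_pathClosure {T : Set BinSeq.{u}}
    (hT : T ⊆ binSeqLT (Ordinal.omega 2)) (hbranch : ∀ B ∈ branches T, #B ≠ ℵ_ 2) {s : BinSeq.{u}}
    (hs : s ∈ pathClosure T) : s.dom < Ordinal.omega 2 := by
  by_contra! hd
  have hseg : ∀ β < Ordinal.omega.{u} 2, ∃ t : T, t.1 ≤ s ∧ t.1.dom = β := fun β hβ => by
    obtain ⟨r, hr, h⟩ := s.exists_lt_dom_eq (hβ.trans_le hd)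
    exact ⟨⟨r, hs r hr⟩, hr.le, h⟩
  refine hbranch {t : T | t.1 ≤ s} ⟨fun t ht r hr _ => le_total_of_le ht hr, fun B hB hsub => ?_⟩ ?_
  · refine hsub.antisymm fun t ht => ?_
    obtain ⟨r, hr, hrd⟩ := hseg _ (hT t.2)
    have : t = r := by
      apply Subtype.ext
      rcases hB.total ht (hsub hr) with h | h
      · exact eq_of_le_of_dom_eq h hrd.symm
      · exact (eq_of_le_of_dom_eq h hrd).symm
    exact this ▸ hr
  · have e : {t : T | t.1 ≤ s} ≃ Iio (Ordinal.omega.{u} 2) := Equiv.ofBijective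
      (fun t => ⟨t.1.1.dom, hT t.1.2⟩) ⟨fun t r h => by
        have h : t.1.1.dom = r.1.1.dom := congrArg Subtype.val h
        exact Subtype.ext (Subtype.ext ((le_of_dom_le t.2 r.2 h.le).antisymm
          (le_of_dom_le r.2 t.2 h.ge))), fun β => by
        obtain ⟨t, ht, h⟩ := hseg β.1 β.2
        exact ⟨⟨t, ht⟩, Subtype.ext h⟩⟩
    rw [mk_congr e, mk_Iio_ordinal, Ordinal.card_omega]
    simp

/-- By maximality a branch consists of all the nodes of `T` below its union, so the union determines
it. -/
theorem mk_branches_le {T : Set BinSeq.{u}} (hT : IsTreeIn (Ordinal.omega 2) T) :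
    #(branches T) ≤ #(pathClosure T) := by
  have h : ∀ B : branches T, ∃ c : pathClosure T, B.1 = {t : T | t.1 ≤ c.1} := by
    rintro ⟨B, hB⟩
    obtain ⟨c, hc, hc'⟩ := exists_isLUB (S := Subtype.val '' B) (by
        rintro _ ⟨s, hs, rfl⟩ _ ⟨t, ht, rfl⟩ -
        exact hB.1.total hs ht)
      ⟨Ordinal.omega 2, by rintro _ ⟨_, ⟨s, -, rfl⟩, rfl⟩; exact (hT.1 s.2).le⟩
    refine ⟨⟨c, fun r hr => ?_⟩, hB.2 ?_ fun t ht => hc.1 ⟨t, ht, rfl⟩⟩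
    · obtain ⟨_, ⟨s, -, rfl⟩, h⟩ := hc' r hr
      exact hT.2 s s.2 r ((dom_lt_of_lt h).trans (hT.1 s.2)) h.le
    · exact fun s hs t ht _ => le_total_of_le hs ht
  choose c hc using h
  refine mk_le_of_injective (f := c) fun B B' hBB => Subtype.ext ?_
  rw [hc B, hc B', hBB]

/-- `BinSeq.{u}` lives one universe up; bounding the lengths allows the space to be taken in `Type
u`. -/
theorem small_pathClosure {T : Set BinSeq.{u}} {κ : Ordinal.{u}}
    (hκ : ∀ s ∈ pathClosure T, s.dom < κ) : Small.{u} (pathClosure T) := by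
  let g : pathClosure T → Σ β : Iio κ, (Iio β.1 → Bool) := fun s => ⟨⟨s.1.dom, hκ s s.2⟩, s.1.val⟩
  refine small_of_injective (f := g) ?_
  rintro ⟨⟨a, f⟩, hs⟩ ⟨⟨a', f'⟩, ht⟩ h
  simp only [g, Sigma.mk.injEq] at h
  obtain ⟨h₁, h₂⟩ := h
  obtain rfl : a = a' := congrArg Subtype.val h₁
  cases h₂
  rfl

/-- The initial segments of a sequence of uncountable cofinality and length below `ω₂` can be
enumerated in type `ω₁`. -/
theorem exists_enumeration {x : BinSeq.{u}} (hx : x.dom < Ordinal.omega 2)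
    (hc : ¬ x.CountablyCofinal) :
    ∃ e : Ordinal.{u} → BinSeq.{u}, (∀ η < Ordinal.omega 1, e η < x) ∧
      ∀ r < x, ∃ η < Ordinal.omega 1, r ≤ e η := by
  classical
  obtain ⟨r₀, hr₀⟩ := exists_lt (isSuccLimit_of_not_countablyCofinal hc)
  have hcard : #(Iio x) ≤ #(Iio (Ordinal.omega.{u} 1)) := by
    have hinj : Function.Injective
        fun r : Iio x => (⟨r.1.dom, dom_lt_of_lt r.2⟩ : Iio x.dom) := fun r s h => by
      have h : r.1.dom = s.1.dom := congrArg Subtype.val h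
      have hr : r.1 ≤ x := le_of_lt r.2
      have hs : s.1 ≤ x := le_of_lt s.2
      exact Subtype.ext ((le_of_dom_le hr hs h.le).antisymm (le_of_dom_le hs hr h.ge))
    refine (mk_le_of_injective hinj).trans ?_
    rw [mk_Iio_ordinal, mk_Iio_ordinal, lift_le, Ordinal.card_omega]
    exact card_le_aleph_one_of_lt_omega_two hx
  obtain ⟨g⟩ := hcard
  have : Nonempty (Iio x) := ⟨⟨r₀, hr₀⟩⟩
  refine ⟨fun η => if h : η < Ordinal.omega 1 then (Function.invFun g ⟨η, h⟩).1 else r₀,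
    fun η hη => ?_, fun r hr => ⟨(g ⟨r, hr⟩).1, (g ⟨r, hr⟩).2, ?_⟩⟩
  · simp only [hη, dif_pos]
    exact (Function.invFun g ⟨η, hη⟩).2
  · have h : (g ⟨r, hr⟩).1 < Ordinal.omega 1 := (g ⟨r, hr⟩).2
    simp only [h, dif_pos]
    have := Function.leftInverse_invFun g.injective ⟨r, hr⟩
    exact (congrArg Subtype.val this).ge

/-! ### The three spaces -/

theorem proposition3p1
    (hCH : (𝔠 : Cardinal.{u}) = ℵ_ 1)
    (T : Set BinSeq.{u})
    (hT : IsTreeIn (Ordinal.omega 2) T)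
    (hlevel : ∀ β : Ordinal.{u}, #(treeLevel T β) ≤ ℵ_ 1)
    (hbranch : ∀ B ∈ branches T, #B ≠ ℵ_ 2)
    (hlarge : 𝔠 < #T ∨ 𝔠 < #(branches T))
    (hcantor : ¬ ContainsCantorTree T) :
    ∃ (X : Type u) (τ τ₀ τ₁ : TopologicalSpace X),
      IsZeroDimT1Lindelof τ ∧ IsZeroDimT1Lindelof τ₀ ∧ IsZeroDimT1Lindelof τ₁ ∧
      ModificationHypotheses τ τ₀ τ₁ := by
  have hdown : ∀ s ∈ T, ∀ t ≤ s, t ∈ T := fun s hs t hts =>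
    hT.2 s hs t (hts.1.trans_lt (hT.1 hs)) hts
  have hdom : ∀ s ∈ pathClosure T, s.dom < Ordinal.omega 2 := fun s hs =>
    dom_lt_omega_two_of_mem_pathClosure hT.1 hbranch hs
  have := small_pathClosure hdom
  let X : Type u := Shrink.{u} (pathClosure T)
  let b : X → BinSeq.{u} := fun x => ((equivShrink (pathClosure T)).symm x).1
  have hb : Function.Injective b :=
    Subtype.val_injective.comp (equivShrink (pathClosure T)).symm.injective
  have hr : range b = pathClosure T := by
    ext s
    constructor
    · rintro ⟨x, rfl⟩
      exact ((equivShrink (pathClosure T)).symm x).2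
    · intro hs
      exact ⟨equivShrink (pathClosure T) ⟨s, hs⟩, by simp [b]⟩
  have hcard : 𝔠 < #X := by
    have hP : (𝔠 : Cardinal.{u + 1}) < #(pathClosure T) := by
      rcases hlarge with h | h
      · exact h.trans_le (mk_le_mk_of_subset fun s hs r hrs => hdown s hs r hrs.le)
      · exact h.trans_le (mk_branches_le hT)
    have hX : lift.{u + 1} #X = #(pathClosure T) := by
      have := lift_mk_eq'.2 ⟨(equivShrink.{u} (pathClosure T)).symm⟩
      rwa [lift_id'.{u, u + 1}] at this
    rw [← lift_lt.{u, u + 1}, hX, lift_continuum]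
    exact hP
  have hsplit : ∀ δ : Ordinal.{u}, ∃ G : Set BinSeq.{u}, δ < Ordinal.omega 2 →
      ∀ (C : List Bool → BinSeq.{u}) (hC : IsBinarySystem T δ C),
      (∃ f, hC.limit f ∉ T ∧ hC.limit f ∈ G) ∧ ∃ f, hC.limit f ∉ T ∧ hC.limit f ∉ G := fun δ => by
    by_cases hδ : δ < Ordinal.omega 2
    · obtain ⟨G, hG⟩ := exists_splitting_limits hCH hlevel hcantor hδ
      exact ⟨G, fun _ => hG⟩
    · exact ⟨∅, fun h => absurd h hδ⟩
  choose G hG using hsplit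
  have hδ : ∀ δ C, IsBinarySystem T δ C → δ < Ordinal.omega 2 := fun δ C hC => by
    have := hdom _ (hC.limit_mem_pathClosure hdown fun _ => true)
    rwa [hC.dom_limit] at this
  -- A limit of a system of height `δ` has length `δ`, so `G x.dom` applies to it the splitting made
  -- for `δ`. Restricting to countable cofinality keeps the points of character `ω₁` non-isolated.
  let E₀ : Set BinSeq.{u} := {x | x.CountablyCofinal ∧ x ∈ G x.dom}
  let E₁ : Set BinSeq.{u} := {x | x.CountablyCofinal ∧ x ∉ G x.dom}
  have hL₀ := lindelofSpace_branchTopology (E := E₀) hb hr hdown hdom (fun x hx => hx.1)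
    fun δ C hC => by
      obtain ⟨f, hf, hfG⟩ := (hG δ (hδ δ C hC) C hC).2
      refine ⟨f, hf, fun h => hfG ?_⟩
      have := h.2
      rwa [hC.dom_limit] at this
  have hL₁ := lindelofSpace_branchTopology (E := E₁) hb hr hdown hdom (fun x hx => hx.1)
    fun δ C hC => by
      obtain ⟨f, hf, hfG⟩ := (hG δ (hδ δ C hC) C hC).1
      exact ⟨f, hf, fun h => h.2 (by rwa [hC.dom_limit])⟩
  have hL := lindelofSpace_branchTopology (E := ∅) hb hr hdown hdom (fun x hx => hx.elim)
    fun δ C hC => by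
      obtain ⟨f, hf, -⟩ := (hG δ (hδ δ C hC) C hC).1
      exact ⟨f, hf, fun h => h⟩
  have henum : ∀ x : X, ¬ (b x).CountablyCofinal → _ := fun x hx =>
    exists_enumeration (hdom _ (hr ▸ mem_range_self x)) hx
  have hchar : ∀ E : Set BinSeq.{u}, (∀ x ∈ E, x.CountablyCofinal) → ∀ x : X,
      ¬ (b x).CountablyCofinal → pointCharacter (branchTopology T E b) x = ℵ_ 1 :=
    fun E hE x hx => by
      obtain ⟨e, he, hcof⟩ := henum x hx
      exact pointCharacter_of_not_countablyCofinal hr hx (fun h => hx (hE _ h)) he hcof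
  have hreg : ∀ E : Set BinSeq.{u}, (∀ x ∈ E, x.CountablyCofinal) →
      @LindelofSpace X (branchTopology T E b) →
      IsRegularT1LindelofCharLE (branchTopology T E b) := fun E hE hL =>
    ⟨regularSpace_of_isZeroDimensional (isZeroDimensional_branchTopology hb),
      t1Space_branchTopology hb, hL, ciSup_le' fun x => by
        by_cases hx : (b x).CountablyCofinal
        · rw [pointCharacter_of_countablyCofinal hx]
          exact aleph0_le_aleph 1
        · exact (hchar E hE x hx).le⟩
  have hzero : ∀ E : Set BinSeq.{u}, @LindelofSpace X (branchTopology T E b) →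
      IsZeroDimT1Lindelof (branchTopology T E b) := fun E hL =>
    ⟨isZeroDimensional_branchTopology hb, t1Space_branchTopology hb, hL⟩
  refine ⟨X, branchTopology T ∅ b, branchTopology T E₀ b, branchTopology T E₁ b, hzero _ hL,
    hzero _ hL₀, hzero _ hL₁, ?_⟩
  refine ⟨?_, hL, hcard, hreg _ (fun x hx => hx.1) hL₀, hreg _ (fun x hx => hx.1) hL₁,
    fun U => isOpen_branchTopology_mono (empty_subset _),
    fun U => isOpen_branchTopology_mono (empty_subset _), fun x => ?_, fun x h _ => ?_,
    fun x h _ => ?_⟩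
  · let _ := branchTopology T ∅ b
    have := t1Space_branchTopology (T := T) (E := ∅) hb
    have := regularSpace_of_isZeroDimensional
      (isZeroDimensional_branchTopology (T := T) (E := ∅) hb)
    infer_instance
  · by_cases hx : (b x).CountablyCofinal
    · rw [pointCharacter_of_countablyCofinal hx, pointCharacter_of_countablyCofinal hx]
    · rw [hchar E₀ (fun x hx => hx.1) x hx, hchar E₁ (fun x hx => hx.1) x hx]
  · have hx : ¬ (b x).CountablyCofinal := fun hx => by
      rw [pointCharacter_of_countablyCofinal hx] at h
      exact aleph0_lt_aleph_one.ne h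
    obtain ⟨e, he, hcof⟩ := henum x hx
    exact ⟨_, isShrinkingClopenSeq_branchTopology hb hr hx he hcof⟩
  · have hx : (b x).CountablyCofinal := by
      by_contra hx
      rw [hchar E₀ (fun x hx => hx.1) x hx] at h
      exact aleph0_lt_aleph_one.ne' h
    -- The point is in exactly one of `E₀`, `E₁`, so its singleton is open in the corresponding
    -- space; the other open set is the whole space.
    by_cases hxG : b x ∈ G (b x).dom
    · exact ⟨{x}, univ, isOpen_singleton_branchTopology fun _ => ⟨hx, hxG⟩,
        (branchTopology T E₁ b).isOpen_univ, inter_univ _⟩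
    · exact ⟨univ, {x}, (branchTopology T E₀ b).isOpen_univ,
        isOpen_singleton_branchTopology fun _ => ⟨hx, hxG⟩, univ_inter _⟩
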